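/- Fix a sequence $\langle C_\alpha:\alpha<\omega_1\rangle$ of sets of ordinals such that $C_{\xi+1}=\{\xi\}$ for every $\xi<\omega_1$, and, for every limit ordinal $\alpha<\omega_1$, $C_\alpha$ is a cofinal subset of $\alpha$ of order type $\omega$. Fix also a sequence $\langle e_\alpha:\alpha<\omega_1\rangle$ of finite-to-one functions $e_\alpha:\alpha\to\omega$ which is coherent: whenever $\alpha<\beta<\omega_1$, the set $\{\xi<\alpha: e_\beta(\xi)\neq e_\alpha(\xi)\}$ is finite. For $\alpha<\beta<\omega_1$ let $\beta=\beta_0>\beta_1>\dots>\beta_l=\alpha$ be the walk from $\beta$ to $\alpha$, given by $\beta_{i+1}=\min(C_{\beta_i}\setminus\alpha)$, put $\xi_k=\max\bigcup_{j\le k}(C_{\beta_j}\cap\alpha)$ for $k<l$ (with the convention $\max\emptyset=0$), and let $L(\alpha,\beta)=\{\xi_k:k<l\}$ be the lower trace of the walk. Writing $L(\alpha,\beta)=\{\eta_0<\eta_1<\dots<\eta_{r-1}\}$ in strictly increasing order, let $$\mathrm{osc}(\alpha,\beta)=\bigl|\{\,i : i+1<r,\ e_\alpha(\eta_i)\le e_\beta(\eta_i)\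 \text{and}\ e_\alpha(\eta_{i+1})>e_\beta(\eta_{i+1})\}\bigr|.$$ **Theorem.** Let $A,B\subseteq\omega_1$ be uncountable. Then for every $n<\omega$ there exist $\alpha\in A$, $\beta_0,\dots,\beta_{n-1}\in B$ and $k_0<\omega$ such that $\alpha<\beta_m$ and $\mathrm{osc}(\alpha,\beta_m)=k_0+m$ for all $m<n$. -/

import Mathlib

open Set Order
open scoped Ordinal

noncomputable section

namespace OrdinalWalk

/-- `C` restricted to the countable ordinals is a C-sequence (ladder system) on `ω₁`:
`C (ξ + 1) = {ξ}`, and for limit `α`, `C α` is a cofinal subset of `α` of order type `ω`.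
The values `C 0` and `C α` for `α ≥ ω₁` are irrelevant to walks between countable ordinals. -/
structure IsCSequence (C : Ordinal.{0} → Set Ordinal.{0}) : Prop where
  succ_eq : ∀ ξ < ω₁, C (succ ξ) = {ξ}
  subset_of_limit : ∀ α < ω₁, IsSuccLimit α → C α ⊆ Iio α
  cofinal_of_limit : ∀ α < ω₁, IsSuccLimit α → ∀ ξ < α, ∃ η ∈ C α, ξ ≤ η
  type_of_limit : ∀ α < ω₁, IsSuccLimit α → typeLT (C α) = ω

/-- The steps of the walk from `β` to `α` along `C`:
`β₀ = β` and `βᵢ₊₁ = min (C βᵢ \ α)`. Only the terms up to the first visit to `α` matter. -/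
def walk (C : Ordinal.{0} → Set Ordinal.{0}) (α β : Ordinal.{0}) : ℕ → Ordinal.{0}
  | 0 => β
  | i + 1 => sInf (C (walk C α β i) \ Iio α)

/-- The number `l` of steps of the walk: the least `l` with `β_l = α`. -/
def walkLength (C : Ordinal.{0} → Set Ordinal.{0}) (α β : Ordinal.{0}) : ℕ :=
  sInf {l : ℕ | walk C α β l = α}

/-- `ξ_k = max ⋃_{j ≤ k} (C β_j ∩ α)`, with the convention `max ∅ = 0`. -/
def lowerPoint (C : Ordinal.{0} → Set Ordinal.{0}) (α β : Ordinal.{0}) (k : ℕ) : Ordinal.{0} :=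
  sSup (⋃ j ≤ k, C (walk C α β j) ∩ Iio α)

/-- The lower trace `L(α, β) = {ξ₀, …, ξ_{l-1}}` of the walk from `β` to `α`. -/
def lowerTrace (C : Ordinal.{0} → Set Ordinal.{0}) (α β : Ordinal.{0}) : Finset Ordinal.{0} :=
  (Finset.range (walkLength C α β)).image (lowerPoint C α β)

/-- `e` codes a coherent sequence of finite-to-one functions `e_α : α → ω`, `α < ω₁`:
only the values `e α ξ` with `ξ < α < ω₁` are meaningful. -/
structure IsCoherentFiniteToOne (e : Ordinal.{0} → Ordinal.{0} → ℕ) : Prop where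
  finite_to_one : ∀ α < ω₁, ∀ k : ℕ, {ξ | ξ < α ∧ e α ξ = k}.Finite
  coherent : ∀ α β, α < β → β < ω₁ → {ξ | ξ < α ∧ e β ξ ≠ e α ξ}.Finite

open Classical in
/-- The set of `ξ ∈ L` such that `f ξ ≤ g ξ` while `f η > g η`, where `η` is the immediate
successor of `ξ` in the finite set `L` (in particular `ξ` is not the last element of `L`). -/
def oscSet (f g : Ordinal.{0} → ℕ) (L : Finset Ordinal.{0}) : Finset Ordinal.{0} :=
  L.filter fun ξ => f ξ ≤ g ξ ∧
    ∃ η ∈ L, ξ < η ∧ (∀ ζ ∈ L, ζ ≤ ξ ∨ η ≤ ζ) ∧ g η < f η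

/-- The number of oscillations of `e_α` and `e_β` along the lower trace `L(α, β)`. -/
def osc (C : Ordinal.{0} → Set Ordinal.{0}) (e : Ordinal.{0} → Ordinal.{0} → ℕ)
    (α β : Ordinal.{0}) : ℕ :=
  (oscSet (e α) (e β) (lowerTrace C α β)).card

lemma step_bounds {C : Ordinal.{0} → Set Ordinal.{0}} (hC : IsCSequence C) {α β : Ordinal.{0}}
    (h : α < β) (hβ : β < ω₁) : α ≤ sInf (C β \ Iio α) ∧ sInf (C β \ Iio α) < β := by
  have key : (C β \ Iio α).Nonempty ∧ C β ⊆ Iio β := by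
    rcases Ordinal.zero_or_succ_or_isSuccLimit β with h0 | ⟨ξ, rfl⟩ | hl
    · exact absurd (h0 ▸ h) not_lt_zero
    · rw [hC.succ_eq ξ ((lt_succ ξ).trans hβ)]
      exact ⟨⟨ξ, rfl, not_lt.2 (lt_succ_iff.1 h)⟩, by simp⟩
    · obtain ⟨η, h1, h2⟩ := hC.cofinal_of_limit β hβ hl α h
      exact ⟨⟨η, h1, not_lt.2 h2⟩, hC.subset_of_limit β hβ hl⟩
  have := csInf_mem key.1
  exact ⟨not_lt.1 this.2, key.2 this.1⟩

/-- The walk from a countable `β` to `α ≤ β` does arrive at `α`. -/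
lemma exists_walk_eq {C : Ordinal.{0} → Set Ordinal.{0}} (hC : IsCSequence C) {α β : Ordinal.{0}}
    (h : α ≤ β) (hβ : β < ω₁) : ∃ l, walk C α β l = α := by
  by_contra! hne
  have hb : ∀ i, α < walk C α β i ∧ walk C α β i < ω₁ := by
    intro i
    induction i with
    | zero => exact ⟨lt_of_le_of_ne h (hne 0).symm, hβ⟩
    | succ i ih =>
      have := step_bounds hC ih.1 ih.2
      exact ⟨lt_of_le_of_ne this.1 (hne (i + 1)).symm, this.2.trans ih.2⟩
  exact (RelEmbedding.natGT (r := (· < ·)) (walk C α β)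
    fun i => (step_bounds hC (hb i).1 (hb i).2).2).not_wellFounded wellFounded_lt

end OrdinalWalk

end

/-!
Let `δ` be a countable limit ordinal that reflects enough statements with finitely many parameters
below `δ` (`IsReflecting`); it plays the role of `M ∩ ω₁` for a countable elementary submodel `M`,
and exists by a closing-off argument (`exists_isReflecting`). Walks through `δ` concatenate: if
`α < δ < β` and all of `L(δ, β)` lies below all of `L(α, δ)`, then `L(α, β) = L(δ, β) ∪ L(α, δ)`
(`lowerTrace_eq_union`).

Take `α ∈ A` and `β ∈ B` above `δ`. Since `δ` itself realizes the pattern of values of `e α`, `e β`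
on the finite set `L(δ, β)`, some `δ' > δ` realizes it too, with witnesses `α'`, `β'`. Then
`L(δ, β') = L(δ, β) ∪ L(δ, δ')`, so that the trace has been end-extended by a nonempty block, on
which `e α' = e β'` because `e α` and `e β` agree near `δ` (`IsReflecting.exists_extension`). As `e`
is finite-to-one, finitely many values of `e α'` can also be made arbitrarily large, while the
values on `L(δ, β)` are kept (`exists_forall_finset_lt`); hence another extension has a block on
which `e α' > e β'` (`IsReflecting.exists_extension_lt`). A block of the first kind followed by one
of the second adds exactly one oscillation (`IsReflecting.exists_card_oscSet_succ`). Iterating gives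
one `α ∈ A` and `β₀, …, β_N ∈ B` above `δ` such that `e α` and `e β_m` have `k₀ + m` oscillations
along `L(δ, β_m)` (`IsReflecting.exists_sequence`).

Finally, reflect `α` to some `α' ∈ A` below `δ`, with the same values on these traces and so close
to `δ` that `L(α', δ)` lies above the traces and above every point of `δ` where some `e β_m` differs
from `e δ`. Then `osc(α', β_m)` is `k₀ + m` plus the number of oscillations of `e α'` and `e δ`
along `L(α', δ)`, which does not depend on `m`.
-/

namespace OrdinalWalk

variable {C : Ordinal.{0} → Set Ordinal.{0}} {e : Ordinal.{0} → Ordinal.{0} → ℕ}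
  {A B : Set Ordinal.{0}} {α β δ η ξ : Ordinal.{0}}

/-! ### Countable ordinals and closing off -/

theorem succ_lt_omega_one {x : Ordinal.{0}} (h : x < ω₁) : succ x < ω₁ :=
  (Cardinal.isSuccLimit_omega 1).succ_lt h

theorem countable_Iio_of_lt_omega_one {x : Ordinal.{0}} (h : x < ω₁) : (Iio x).Countable := by
  rw [← Cardinal.le_aleph0_iff_set_countable, Cardinal.mk_Iio_ordinal, Cardinal.lift_le_aleph0]
  rwa [← Order.lt_succ_iff, Cardinal.succ_aleph0, ← Cardinal.lt_ord, Cardinal.ord_aleph]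

/-- Closing off: the finite parameters are a finite set of ordinals, each labelled by two natural
numbers, and one further ordinal; there are only countably many of them below a countable ordinal,
so `G` has a limit closure point below `ω₁`. -/
theorem exists_isSuccLimit_closed (G : Finset (Ordinal.{0} × ℕ × ℕ) → Ordinal.{0} → Ordinal.{0})
    (hG : ∀ p, ∀ η < ω₁, G p η < ω₁) :
    ∃ δ < ω₁, IsSuccLimit δ ∧ ∀ p : Finset (Ordinal.{0} × ℕ × ℕ), (∀ x ∈ p, x.1 < δ) →
      ∀ η < δ, G p η < δ := by
  classical
  have key : ∀ γ < ω₁, ∃ γ' < ω₁, γ < γ' ∧ ∀ p : Finset (Ordinal.{0} × ℕ × ℕ),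
      (∀ x ∈ p, x.1 < γ) → ∀ η < γ, G p η < γ' := by
    intro γ hγ
    have := (countable_Iio_of_lt_omega_one hγ).to_subtype
    let H : Finset (Iio γ × ℕ × ℕ) × Iio γ → Ordinal.{0} := fun q =>
      G (q.1.image fun x => (x.1.1, x.2)) q.2
    have hH : ⨆ q, H q < ω₁ := Ordinal.iSup_lt_omega_one fun q => hG _ _ (lt_trans q.2.2 hγ)
    refine ⟨max (succ γ) (succ (⨆ q, H q)), max_lt (succ_lt_omega_one hγ) (succ_lt_omega_one hH),
      lt_max_of_lt_left (lt_succ γ), fun p hp η hη => lt_max_of_lt_right (lt_succ_of_le ?_)⟩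
    have h1 : H (p.attach.image fun x => (⟨x.1.1, hp x.1 x.2⟩, x.1.2), ⟨η, hη⟩) = G p η := by
      simp only [H]
      congr 1
      ext x
      simp only [Finset.mem_image, Finset.mem_attach, true_and]
      constructor
      · rintro ⟨_, ⟨y, rfl⟩, h⟩
        exact h ▸ y.2
      · exact fun h => ⟨_, ⟨⟨x, h⟩, rfl⟩, rfl⟩
    rw [← h1]
    exact Ordinal.le_iSup H _
  choose! g hg1 hg2 hg3 using key
  let s : ℕ → Ordinal.{0} := fun n => g^[n] 0
  have hs : ∀ n, s (n + 1) = g (s n) := fun n => Function.iterate_succ_apply' g n 0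
  have hs1 : ∀ n, s n < ω₁ := by
    intro n
    induction n with
    | zero => exact Ordinal.omega_pos 1
    | succ n ih => rw [hs]; exact hg1 _ ih
  have hs2 : StrictMono s := strictMono_nat_of_lt_succ fun n => by rw [hs]; exact hg2 _ (hs1 n)
  have hlt : ∀ {x}, x < ⨆ n, s n ↔ ∃ n, x < s n := Ordinal.lt_iSup_iff
  refine ⟨⨆ n, s n, Ordinal.iSup_lt_omega_one hs1, ?_, fun p hp η hη => ?_⟩
  · refine Ordinal.isSuccLimit_iff.2 ⟨?_, isSuccPrelimit_of_succ_lt fun a ha => ?_⟩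
    · exact (bot_le.trans_lt (hlt.2 ⟨1, hs2 one_pos⟩)).ne'
    · obtain ⟨n, hn⟩ := hlt.1 ha
      exact hlt.2 ⟨n + 1, (succ_le_of_lt hn).trans_lt (hs2 n.lt_succ_self)⟩
  · have h1 : ∃ n, η < s n ∧ ∀ x ∈ p, x.1 < s n := by
      obtain ⟨m, hm⟩ := hlt.1 hη
      have : ∀ x : p, ∃ n, x.1.1 < s n := fun x => hlt.1 (hp x.1 x.2)
      choose k hk using this
      refine ⟨max m (p.attach.sup k), hm.trans_le (hs2.monotone (le_max_left _ _)), fun x hx => ?_⟩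
      exact (hk ⟨x, hx⟩).trans_le (hs2.monotone
        (le_max_of_le_right (Finset.le_sup (f := k) (Finset.mem_attach p ⟨x, hx⟩))))
    obtain ⟨n, hn1, hn2⟩ := h1
    exact hlt.2 ⟨n + 1, by rw [hs]; exact hg3 _ (hs1 n) p hn2 η hn1⟩

/-! ### Walks and lower traces -/

theorem finite_inter_Iio (hC : IsCSequence C) (h : δ < β) (hβ : β < ω₁) : (C β ∩ Iio δ).Finite := by
  rcases Ordinal.zero_or_succ_or_isSuccLimit β with h0 | ⟨ξ, rfl⟩ | hl
  · exact absurd (h0 ▸ h) not_lt_zero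
  · rw [hC.succ_eq ξ ((lt_succ ξ).trans hβ)]
    exact (finite_singleton ξ).subset inter_subset_left
  -- `C β ∩ δ` is contained in a proper initial segment of `C β`, whose order type is below `ω`.
  · obtain ⟨η, h1, h2⟩ := hC.cofinal_of_limit β hβ hl δ h
    have h3 := Ordinal.typein_lt_type (fun x y : C β => x < y) ⟨η, h1⟩
    have h4 := hC.type_of_limit β hβ hl
    rw [h4] at h3
    have h5 := Ordinal.card_typein (r := fun x y : C β => x < y) ⟨η, h1⟩
    obtain ⟨n, hn⟩ := Ordinal.lt_omega0.1 h3
    rw [hn, Ordinal.card_nat] at h5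
    have : Finite {y : C β // y < ⟨η, h1⟩} := by
      exact Cardinal.mk_lt_aleph0_iff.1 (h5 ▸ Cardinal.natCast_lt_aleph0)
    have := (Set.finite_range fun y : {y : C β // y < ⟨η, h1⟩} => (y : Ordinal.{0}))
    refine this.subset fun x hx => ⟨⟨⟨x, hx.1⟩, ?_⟩, rfl⟩
    exact Subtype.mk_lt_mk.2 (lt_of_lt_of_le hx.2 h2)

theorem walk_walkLength (hC : IsCSequence C) (h : α ≤ β) (hβ : β < ω₁) :
    walk C α β (walkLength C α β) = α :=
  Nat.sInf_mem (s := {l : ℕ | walk C α β l = α}) (exists_walk_eq hC h hβ)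

theorem walk_ne_of_lt_walkLength {i : ℕ} (hi : i < walkLength C α β) : walk C α β i ≠ α :=
  Nat.notMem_of_lt_sInf (s := {l : ℕ | walk C α β l = α}) hi

theorem walkLength_eq {n : ℕ} (h : walk C α β n = α) (h' : ∀ i < n, walk C α β i ≠ α) :
    walkLength C α β = n :=
  le_antisymm (Nat.sInf_le h) (le_csInf ⟨n, h⟩ fun _ hi => not_lt.1 fun hlt => h' _ hlt hi)

theorem walkLength_pos (hC : IsCSequence C) (h : α < β) (hβ : β < ω₁) : 0 < walkLength C α β := by
  rw [Nat.pos_iff_ne_zero]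
  intro h0
  have := walk_walkLength hC h.le hβ
  rw [h0] at this
  exact h.ne' this

theorem lt_walk (hC : IsCSequence C) (h : α ≤ β) (hβ : β < ω₁) {i : ℕ}
    (hi : i < walkLength C α β) : α < walk C α β i ∧ walk C α β i ≤ β := by
  induction i with
  | zero => exact ⟨lt_of_le_of_ne h (walk_ne_of_lt_walkLength hi).symm, le_rfl⟩
  | succ i ih =>
    have h1 := ih (by omega)
    have h2 := step_bounds hC h1.1 (h1.2.trans_lt hβ)
    exact ⟨lt_of_le_of_ne h2.1 (walk_ne_of_lt_walkLength hi).symm, h2.2.le.trans h1.2⟩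

theorem mem_lowerTrace : ξ ∈ lowerTrace C α β ↔ ∃ k < walkLength C α β, lowerPoint C α β k = ξ := by
  simp [lowerTrace]

theorem lowerTrace_nonempty (hC : IsCSequence C) (h : α < β) (hβ : β < ω₁) :
    (lowerTrace C α β).Nonempty :=
  ⟨_, mem_lowerTrace.2 ⟨0, walkLength_pos hC h hβ, rfl⟩⟩

theorem lowerPoint_le (k : ℕ) : lowerPoint C α β k ≤ α :=
  csSup_le' fun _ hx => by
    simp only [mem_iUnion] at hx
    obtain ⟨_, _, hx⟩ := hx
    exact hx.2.le

theorem le_lowerPoint {j k : ℕ} (hjk : j ≤ k) (hη : η ∈ C (walk C α β j)) (h : η < α) :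
    η ≤ lowerPoint C α β k := by
  refine le_csSup ⟨α, ?_⟩ (mem_iUnion₂.2 ⟨j, hjk, hη, h⟩)
  intro x hx
  simp only [mem_iUnion] at hx
  obtain ⟨_, _, hx⟩ := hx
  exact hx.2.le

/-- Every term of the walk before `α` has only finitely many ladder points below `α`, so the maxima
defining the lower trace are attained. -/
theorem lt_of_mem_lowerTrace (hC : IsCSequence C) (hα : 0 < α) (h : α < β) (hβ : β < ω₁)
    (hξ : ξ ∈ lowerTrace C α β) : ξ < α := by
  obtain ⟨k, hk, rfl⟩ := mem_lowerTrace.1 hξ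
  have hfin : (⋃ j ≤ k, C (walk C α β j) ∩ Iio α).Finite := by
    refine (finite_Iic k).biUnion fun j hj => ?_
    have := lt_walk hC h.le hβ (lt_of_le_of_lt hj hk)
    exact finite_inter_Iio hC this.1 (this.2.trans_lt hβ)
  rcases eq_empty_or_nonempty (⋃ j ≤ k, C (walk C α β j) ∩ Iio α) with h0 | h0
  · rw [lowerPoint, h0, csSup_empty]
    exact hα
  · refine (hfin.csSup_lt_iff h0).2 fun x hx => ?_
    simp only [mem_iUnion] at hx
    obtain ⟨_, _, hx⟩ := hx
    exact hx.2

/-- A ladder point of `β` below `α` bounds the whole lower trace from below, since it is seen at the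
very first step of the walk. -/
theorem le_of_mem_lowerTrace (hη : η ∈ C β) (h : η < α) (hξ : ξ ∈ lowerTrace C α β) : η ≤ ξ := by
  obtain ⟨k, -, rfl⟩ := mem_lowerTrace.1 hξ
  exact le_lowerPoint (Nat.zero_le k) hη h

/-- The walk from `β` to `α` passes through `δ` when `L(δ, β)` lies below `L(α, δ)`, and its lower
trace is then made of the two partial ones. -/
theorem lowerTrace_eq_union (hC : IsCSequence C) (hαδ : α < δ) (hδβ : δ < β) (hβ : β < ω₁)
    (h : ∀ ξ ∈ lowerTrace C δ β, ∀ ζ ∈ lowerTrace C α δ, ξ < ζ) :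
    lowerTrace C α β = lowerTrace C δ β ∪ lowerTrace C α δ := by
  have hδ := hδβ.trans hβ
  set l := walkLength C δ β with hl
  have hlt : ∀ ξ ∈ lowerTrace C δ β, ξ < α := fun ξ hξ => by
    obtain ⟨ζ, hζ⟩ := lowerTrace_nonempty hC hαδ hδ
    obtain ⟨k, -, rfl⟩ := mem_lowerTrace.1 hζ
    exact (h ξ hξ _ hζ).trans_le (lowerPoint_le k)
  -- No ladder met on the way from `β` to `δ` has a point in `[α, δ)`.
  have hmem : ∀ j < l, ∀ x ∈ C (walk C δ β j), x < δ ↔ x < α := fun j hj x hx =>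
    ⟨fun hxδ => (le_lowerPoint le_rfl hx hxδ).trans_lt (hlt _ (mem_lowerTrace.2 ⟨j, hj, rfl⟩)),
      fun hxα => hxα.trans hαδ⟩
  have hwalk : ∀ j ≤ l, walk C α β j = walk C δ β j := by
    intro j
    induction j with
    | zero => exact fun _ => rfl
    | succ j ih =>
      intro hj
      simp only [walk]
      rw [ih (by omega)]
      congr 1
      ext x
      simp only [mem_sdiff, mem_Iio]
      exact and_congr_right fun hx => not_congr (hmem j hj x hx).symm
  have hwalk' : ∀ j, walk C α β (l + j) = walk C α δ j := by
    intro j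
    induction j with
    | zero => exact (hwalk l le_rfl).trans (walk_walkLength hC hδβ.le hβ)
    | succ j ih => rw [← add_assoc]; simp only [walk]; rw [ih]
  have hlen : walkLength C α β = l + walkLength C α δ := by
    refine walkLength_eq ((hwalk' _).trans (walk_walkLength hC hαδ.le hδ)) fun i hi => ?_
    rcases lt_or_ge i l with hil | hil
    · rw [hwalk i hil.le]
      exact (hαδ.trans (lt_walk hC hδβ.le hβ hil).1).ne'
    · obtain ⟨j, rfl⟩ := Nat.exists_eq_add_of_le hil
      rw [hwalk']
      exact walk_ne_of_lt_walkLength (by omega)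
  have hpoint : ∀ k < l, lowerPoint C α β k = lowerPoint C δ β k := by
    intro k hk
    refine congrArg sSup (iUnion₂_congr fun j hj => ?_)
    rw [hwalk j (by omega)]
    ext x
    exact and_congr_right fun hx => (hmem j (by omega) x hx).symm
  have hpoint' : ∀ k < walkLength C α δ, lowerPoint C α β (l + k) = lowerPoint C α δ k := by
    intro k hk
    apply le_antisymm
    · refine csSup_le' fun x hx => ?_
      simp only [mem_iUnion] at hx
      obtain ⟨j, hj, hx, hxα⟩ := hx
      rcases lt_or_ge j l with hjl | hjl
      · rw [hwalk j hjl.le] at hx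
        exact (le_lowerPoint le_rfl hx (hxα.trans hαδ)).trans (h _ (mem_lowerTrace.2 ⟨j, hjl, rfl⟩)
          _ (mem_lowerTrace.2 ⟨k, hk, rfl⟩)).le
      · obtain ⟨i, rfl⟩ := Nat.exists_eq_add_of_le hjl
        rw [hwalk'] at hx
        exact le_lowerPoint (by omega) hx hxα
    · refine csSup_le' fun x hx => ?_
      simp only [mem_iUnion] at hx
      obtain ⟨j, hj, hx, hxα⟩ := hx
      rw [← hwalk'] at hx
      exact le_lowerPoint (by omega) hx hxα
  ext ξ
  rw [Finset.mem_union, mem_lowerTrace, mem_lowerTrace, mem_lowerTrace, hlen]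
  constructor
  · rintro ⟨k, hk, rfl⟩
    rcases lt_or_ge k l with hkl | hkl
    · exact .inl ⟨k, hkl, (hpoint k hkl).symm⟩
    · obtain ⟨i, rfl⟩ := Nat.exists_eq_add_of_le hkl
      exact .inr ⟨i, by omega, (hpoint' i (by omega)).symm⟩
  · rintro (⟨k, hk, rfl⟩ | ⟨k, hk, rfl⟩)
    · exact ⟨k, by omega, hpoint k hk⟩
    · exact ⟨l + k, by omega, hpoint' k hk⟩

/-! ### Counting oscillations along unions of blocks -/

theorem oscSet_congr {f g f' g' : Ordinal.{0} → ℕ} {L : Finset Ordinal.{0}}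
    (hf : ∀ ξ ∈ L, f ξ = f' ξ) (hg : ∀ ξ ∈ L, g ξ = g' ξ) : oscSet f g L = oscSet f' g' L := by
  refine Finset.filter_congr fun ξ hξ => ?_
  rw [hf ξ hξ, hg ξ hξ]
  refine and_congr_right fun _ => exists_congr fun η => and_congr_right fun hη => ?_
  rw [hf η hη, hg η hη]

theorem oscSet_eq_empty_of_le {f g : Ordinal.{0} → ℕ} {L : Finset Ordinal.{0}}
    (h : ∀ ξ ∈ L, f ξ ≤ g ξ) : oscSet f g L = ∅ :=
  Finset.filter_eq_empty_iff.2 fun _ _ hh => by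
    obtain ⟨-, η, hη, -, -, h2⟩ := hh
    exact h2.not_ge (h η hη)

theorem oscSet_eq_empty_of_lt {f g : Ordinal.{0} → ℕ} {L : Finset Ordinal.{0}}
    (h : ∀ ξ ∈ L, g ξ < f ξ) : oscSet f g L = ∅ :=
  Finset.filter_eq_empty_iff.2 fun ξ hξ hh => hh.1.not_gt (h ξ hξ)

open Classical in
/-- The only new oscillation of a union of consecutive blocks is at the junction. -/
theorem oscSet_union {f g : Ordinal.{0} → ℕ} {L M : Finset Ordinal.{0}}
    (h : ∀ ξ ∈ L, ∀ ζ ∈ M, ξ < ζ) (hL : L.Nonempty) (hM : M.Nonempty) :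
    oscSet f g (L ∪ M) = oscSet f g L ∪ oscSet f g M ∪
      if f (L.max' hL) ≤ g (L.max' hL) ∧ g (M.min' hM) < f (M.min' hM) then {L.max' hL} else ∅ := by
  have ha := L.max'_mem hL
  have hb := M.min'_mem hM
  have ha' : ∀ x ∈ L, x ≤ L.max' hL := fun x hx => L.le_max' x hx
  have hb' : ∀ x ∈ M, M.min' hM ≤ x := fun x hx => M.min'_le x hx
  generalize L.max' hL = a at *
  generalize M.min' hM = b at *
  ext ξ
  have key : ξ ∈ (if f a ≤ g a ∧ g b < f b then ({a} : Finset Ordinal.{0}) else ∅) ↔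
      ξ = a ∧ f a ≤ g a ∧ g b < f b := by
    split_ifs with hh <;> simp [hh]
  simp only [Finset.mem_union, key, oscSet, Finset.mem_filter]
  constructor
  · rintro ⟨hξ | hξ, h1, η, hη | hη, h2, h3, h4⟩
    · exact .inl (.inl ⟨hξ, h1, η, hη, h2, fun ζ hζ => h3 ζ (.inl hζ), h4⟩)
    · have e1 : ξ = a := le_antisymm (ha' _ hξ)
        ((h3 a (.inl ha)).resolve_right (h a ha η hη).not_ge)
      have e2 : η = b := le_antisymm
        ((h3 b (.inr hb)).resolve_left (h ξ hξ b hb).not_ge) (hb' _ hη)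
      subst e1 e2
      exact .inr ⟨rfl, h1, h4⟩
    · exact absurd (h η hη ξ hξ) h2.not_gt
    · exact .inl (.inr ⟨hξ, h1, η, hη, h2, fun ζ hζ => h3 ζ (.inr hζ), h4⟩)
  · rintro ((⟨hξ, h1, η, hη, h2, h3, h4⟩ | ⟨hξ, h1, η, hη, h2, h3, h4⟩) | ⟨rfl, h1, h2⟩)
    · exact ⟨.inl hξ, h1, η, .inl hη, h2, fun ζ hζ => hζ.elim (h3 ζ)
        fun hζ => .inr (h η hη ζ hζ).le, h4⟩
    · exact ⟨.inr hξ, h1, η, .inr hη, h2, fun ζ hζ => hζ.elim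
        (fun hζ => .inl (h ζ hζ ξ hξ).le) (h3 ζ), h4⟩
    · exact ⟨.inl ha, h1, b, .inr hb, h _ ha b hb, fun ζ hζ => hζ.imp (ha' ζ) (hb' ζ), h2⟩

theorem oscSet_subset {f g : Ordinal.{0} → ℕ} {L : Finset Ordinal.{0}} : oscSet f g L ⊆ L :=
  Finset.filter_subset _ _

theorem card_oscSet_union_of_lt {f g : Ordinal.{0} → ℕ} {L M : Finset Ordinal.{0}}
    (h : ∀ ξ ∈ L, ∀ ζ ∈ M, ξ < ζ) (hL : L.Nonempty) (hM : M.Nonempty)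
    (hlt : g (L.max' hL) < f (L.max' hL)) :
    (oscSet f g (L ∪ M)).card = (oscSet f g L).card + (oscSet f g M).card := by
  classical
  rw [oscSet_union h hL hM, if_neg fun hh => hh.1.not_gt hlt, Finset.union_empty]
  refine Finset.card_union_of_disjoint (Finset.disjoint_left.2 fun ξ h1 h2 => ?_)
  exact (h ξ (oscSet_subset h1) ξ (oscSet_subset h2)).false

/-- Appending a block where `f ≤ g` and then a block where `f > g` adds one oscillation. -/
theorem card_oscSet_union_union {f g : Ordinal.{0} → ℕ} {L M N : Finset Ordinal.{0}}
    (hLM : ∀ ξ ∈ L, ∀ ζ ∈ M, ξ < ζ) (hN : ∀ ξ ∈ L ∪ M, ∀ ζ ∈ N, ξ < ζ)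
    (hL₀ : L.Nonempty) (hM₀ : M.Nonempty) (hN₀ : N.Nonempty)
    (hM : ∀ ξ ∈ M, f ξ ≤ g ξ) (hN' : ∀ ξ ∈ N, g ξ < f ξ) :
    (oscSet f g (L ∪ M ∪ N)).card = (oscSet f g L).card + 1 := by
  classical
  have hmax : (L ∪ M).max' (hL₀.mono Finset.subset_union_left) ∈ M := by
    obtain ⟨b, hb⟩ := hM₀
    have h1 := Finset.le_max' (L ∪ M) b (Finset.mem_union_right _ hb)
    rcases Finset.mem_union.1 (Finset.max'_mem (L ∪ M) (hL₀.mono Finset.subset_union_left))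
      with h | h
    · exact absurd h1 (hLM _ h b hb).not_ge
    · exact h
  rw [oscSet_union hN (hL₀.mono Finset.subset_union_left) hN₀,
    if_pos ⟨hM _ hmax, hN' _ (N.min'_mem hN₀)⟩, oscSet_eq_empty_of_lt hN', Finset.union_empty,
    oscSet_union hLM hL₀ hM₀, if_neg fun hh => hh.2.not_ge (hM _ (M.min'_mem hM₀)),
    oscSet_eq_empty_of_le hM, Finset.union_empty, Finset.union_empty,
    Finset.card_union_of_disjoint, Finset.card_singleton]
  exact Finset.disjoint_singleton_right.2 fun hh => (hLM _ (oscSet_subset hh) _ hmax).false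

/-! ### Large values of finite-to-one functions -/

/-- For uncountable `A` there is a countable ordinal `x` such that, for any finite set `L` beyond `x`,
there are arbitrarily large `α ∈ A` for which `e α` is large on `L`: otherwise infinitely many
disjoint finite sets fail for the same bound `n`, and one `α ∈ A` above all of them takes values at
most `n` infinitely often. For countable `A`, `x` is chosen above `A` and the claim is void. -/
theorem exists_forall_finset_lt (he : IsCoherentFiniteToOne e) (hA : A ⊆ Iio ω₁) :
    ∃ x < ω₁, (∃ α ∈ A, x ≤ α) → ∀ L : Finset Ordinal.{0}, (∀ ξ ∈ L, x ≤ ξ ∧ ξ < ω₁) →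
      ∀ n : ℕ, ∀ ζ < ω₁, ∃ α ∈ A, ζ < α ∧ ∀ ξ ∈ L, n < e α ξ := by
  have h0 : (0 : Ordinal.{0}) < ω₁ := Ordinal.omega_pos 1
  by_cases hbdd : ∃ y < ω₁, ∀ α ∈ A, α ≤ y
  · obtain ⟨y, hy, hyA⟩ := hbdd
    exact ⟨succ y, succ_lt_omega_one hy, fun ⟨α, hα, h⟩ =>
      absurd (hyA α hα) (succ_le_iff.1 h).not_ge⟩
  push Not at hbdd
  suffices h : ∀ n : ℕ, ∃ x < ω₁, ∀ L : Finset Ordinal.{0}, (∀ ξ ∈ L, x ≤ ξ ∧ ξ < ω₁) →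
      ∀ ζ < ω₁, ∃ α ∈ A, ζ < α ∧ ∀ ξ ∈ L, n < e α ξ by
    choose x hx h using h
    exact ⟨⨆ n, x n, Ordinal.iSup_lt_omega_one hx, fun _ L hL n =>
      h n L fun ξ hξ => ⟨(Ordinal.le_iSup x n).trans (hL ξ hξ).1, (hL ξ hξ).2⟩⟩
  intro n
  by_contra! hbad
  -- Each bad finite set contributes an element of a level set of `e α`, for all large `α ∈ A`.
  have hstep : ∀ x < ω₁, ∃ x' < ω₁, ∀ α ∈ A, x' ≤ α → ∃ ξ, x ≤ ξ ∧ ξ < x' ∧ e α ξ ≤ n := by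
    intro x hx
    obtain ⟨L, hL, ζ, hζ, h⟩ := hbad x hx
    have hsup : L.sup id < ω₁ := (Finset.sup_lt_iff h0).2 fun ξ hξ => (hL ξ hξ).2
    refine ⟨succ (max ζ (L.sup id)), succ_lt_omega_one (max_lt hζ hsup), fun α hα hle => ?_⟩
    obtain ⟨ξ, hξ, hn⟩ := h α hα ((le_max_left _ _).trans_lt (succ_le_iff.1 hle))
    exact ⟨ξ, (hL ξ hξ).1,
      lt_succ_of_le ((Finset.le_sup (f := id) hξ).trans (le_max_right _ _)), hn⟩
  choose! g hg hg' using hstep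
  let s : ℕ → Ordinal.{0} := fun k => g^[k] 0
  have hs : ∀ k, s (k + 1) = g (s k) := fun k => Function.iterate_succ_apply' g k 0
  have hs1 : ∀ k, s k < ω₁ := by
    intro k
    induction k with
    | zero => exact h0
    | succ k ih => rw [hs]; exact hg _ ih
  obtain ⟨α, hα, hαs⟩ := hbdd _ (Ordinal.iSup_lt_omega_one hs1)
  have hle : ∀ k, s k < α := fun k => (Ordinal.le_iSup s k).trans_lt hαs
  have hex : ∀ k, ∃ ξ, s k ≤ ξ ∧ ξ < s (k + 1) ∧ e α ξ ≤ n := fun k => by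
    have := hg' (s k) (hs1 k) α hα
    rw [← hs] at this
    exact this (hle _).le
  choose ξ h1 h2 h3 using hex
  have hmono : StrictMono ξ := strictMono_nat_of_lt_succ fun k => (h2 k).trans_le (h1 (k + 1))
  have hfin : (⋃ k ≤ n, {ξ | ξ < α ∧ e α ξ = k}).Finite :=
    (finite_Iic n).biUnion fun k _ => he.finite_to_one α (hA hα) k
  refine infinite_range_of_injective hmono.injective (hfin.subset ?_)
  rintro _ ⟨k, rfl⟩
  exact mem_iUnion₂.2 ⟨e α (ξ k), h3 k, (h2 k).trans (hle _), rfl⟩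

/-! ### Reflecting ordinals -/

/-- The lower trace `L(δ, β)` with each of its points `ξ` labelled by `e α ξ` and `e β ξ`. -/
noncomputable def pattern (C : Ordinal.{0} → Set Ordinal.{0}) (e : Ordinal.{0} → Ordinal.{0} → ℕ)
    (δ α β : Ordinal.{0}) : Finset (Ordinal.{0} × ℕ × ℕ) :=
  (lowerTrace C δ β).image fun ξ => (ξ, e α ξ, e β ξ)

/-- The elements `α` of `A` for which `e α` takes the values given by the first labels of `p`. -/
def matching (e : Ordinal.{0} → Ordinal.{0} → ℕ) (A : Set Ordinal.{0})
    (p : Finset (Ordinal.{0} × ℕ × ℕ)) : Set Ordinal.{0} :=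
  {α ∈ A | ∀ x ∈ p, e α x.1 = x.2.1}

/-- The limit ordinals `δ` that have `η` as a ladder point and realize the pattern `p` through some
`α ∈ A` and `β ∈ B` above `δ` for which `e α` and `e β` agree on `[η, δ)`. -/
def patternLevels (C : Ordinal.{0} → Set Ordinal.{0}) (e : Ordinal.{0} → Ordinal.{0} → ℕ)
    (A B : Set Ordinal.{0}) (p : Finset (Ordinal.{0} × ℕ × ℕ)) (η : Ordinal.{0}) :
    Set Ordinal.{0} :=
  {δ | δ < ω₁ ∧ IsSuccLimit δ ∧ η ∈ C δ ∧ ∃ α ∈ A, ∃ β ∈ B, δ < α ∧ δ < β ∧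
    pattern C e δ α β = p ∧ ∀ ξ, η ≤ ξ → ξ < δ → e α ξ = e β ξ}

/-- `δ` is a countable limit ordinal with the consequences used here of being `M ∩ ω₁` for a
countable elementary submodel `M` containing `C`, `e`, `A` and `B`. For parameters below `δ`: a set
`patternLevels C e A B p η` that contains `δ` has an element above `δ`; a set `matching e A p` with
an element above `δ` has elements arbitrarily close below `δ`, and elements above `δ` with large
values on any given finite set that lies above some `x < δ`. -/
structure IsReflecting (C : Ordinal.{0} → Set Ordinal.{0}) (e : Ordinal.{0} → Ordinal.{0} → ℕ)
    (A B : Set Ordinal.{0}) (δ : Ordinal.{0}) : Prop where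
  lt_omega_one : δ < ω₁
  isSuccLimit : IsSuccLimit δ
  exists_gt : ∀ p : Finset (Ordinal.{0} × ℕ × ℕ), (∀ x ∈ p, x.1 < δ) → ∀ η < δ,
    δ ∈ patternLevels C e A B p η → ∃ δ' ∈ patternLevels C e A B p η, δ < δ'
  exists_large : ∀ p : Finset (Ordinal.{0} × ℕ × ℕ), (∀ x ∈ p, x.1 < δ) →
    (∃ α ∈ matching e A p, δ ≤ α) → ∃ x < δ, ∀ L : Finset Ordinal.{0},
      (∀ ξ ∈ L, x ≤ ξ ∧ ξ < ω₁) → ∀ n : ℕ, ∃ α ∈ matching e A p, δ < α ∧ ∀ ξ ∈ L, n < e α ξ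
  exists_lt : ∀ p : Finset (Ordinal.{0} × ℕ × ℕ), (∀ x ∈ p, x.1 < δ) → ∀ η < δ,
    (∃ α ∈ matching e A p, δ ≤ α) → ∃ α ∈ matching e A p, η < α ∧ α < δ

theorem exists_isReflecting (C : Ordinal.{0} → Set Ordinal.{0}) (he : IsCoherentFiniteToOne e)
    (hA : A ⊆ Iio ω₁) : ∃ δ, IsReflecting C e A B δ := by
  have h0 : (0 : Ordinal.{0}) < ω₁ := Ordinal.omega_pos 1
  have h₁ : ∀ p η, ∃ x < ω₁, ∀ d ∈ patternLevels C e A B p η, x ≤ d →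
      ∃ d' ∈ patternLevels C e A B p η, d < d' := by
    intro p η
    by_cases hbdd : ∃ y < ω₁, ∀ d ∈ patternLevels C e A B p η, d ≤ y
    · obtain ⟨y, hy, h⟩ := hbdd
      exact ⟨succ y, succ_lt_omega_one hy, fun d hd hyd =>
        absurd (h d hd) (succ_le_iff.1 hyd).not_ge⟩
    · push Not at hbdd
      exact ⟨0, h0, fun d hd _ => hbdd d hd.1⟩
  have h₂ := fun p => exists_forall_finset_lt he (A := matching e A p) fun α hα => hA hα.1
  have h₃ : ∀ p η, ∃ x < ω₁, (∃ α ∈ matching e A p, η < α) →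
      ∃ α ∈ matching e A p, η < α ∧ α < x := by
    intro p η
    by_cases h : ∃ α ∈ matching e A p, η < α
    · obtain ⟨α, hα, hηα⟩ := h
      exact ⟨succ α, succ_lt_omega_one (hA hα.1), fun _ => ⟨α, hα, hηα, lt_succ α⟩⟩
    · exact ⟨0, h0, fun hh => absurd hh h⟩
  choose x₁ hx₁ h₁ using h₁
  choose x₂ hx₂ h₂ using h₂
  choose x₃ hx₃ h₃ using h₃
  obtain ⟨δ, hδ, hlim, hcl⟩ := exists_isSuccLimit_closed
    (fun p η => max (x₁ p η) (max (x₂ p) (x₃ p η)))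
    fun p η _ => max_lt (hx₁ p η) (max_lt (hx₂ p) (hx₃ p η))
  refine ⟨δ, hδ, hlim, fun p hp η hη hd => ?_, fun p hp ⟨α, hα, hδα⟩ => ?_,
    fun p hp η hη ⟨α, hα, hδα⟩ => ?_⟩
  · exact h₁ p η δ hd ((le_max_left _ _).trans_lt (hcl p hp η hη)).le
  · have hlt : x₂ p < δ := (le_max_of_le_right (le_max_left _ _)).trans_lt
      (hcl p hp 0 hlim.bot_lt)
    exact ⟨x₂ p, hlt, fun L hL n => h₂ p ⟨α, hα, hlt.le.trans hδα⟩ L hL n δ hδ⟩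
  · obtain ⟨α', h1, h2, h3⟩ := h₃ p η ⟨α, hα, hη.trans_le hδα⟩
    exact ⟨α', h1, h2, h3.trans ((le_max_of_le_right (le_max_right _ _)).trans_lt (hcl p hp η hη))⟩

theorem fst_lt_of_mem_pattern (hC : IsCSequence C) (hδ : 0 < δ) (h : δ < β) (hβ : β < ω₁) :
    ∀ x ∈ pattern C e δ α β, x.1 < δ := by
  intro x hx
  obtain ⟨ξ, hξ, rfl⟩ := Finset.mem_image.1 hx
  exact lt_of_mem_lowerTrace hC hδ h hβ hξ

theorem mem_matching_pattern {α' : Ordinal.{0}} :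
    α' ∈ matching e A (pattern C e δ α β) ↔
      α' ∈ A ∧ ∀ ξ ∈ lowerTrace C δ β, e α' ξ = e α ξ := by
  simp [matching, pattern]

theorem pattern_eq_iff {δ' α' β' : Ordinal.{0}} :
    pattern C e δ' α' β' = pattern C e δ α β ↔ lowerTrace C δ' β' = lowerTrace C δ β ∧
      ∀ ξ ∈ lowerTrace C δ β, e α' ξ = e α ξ ∧ e β' ξ = e β ξ := by
  constructor
  · intro h
    have hL : lowerTrace C δ' β' = lowerTrace C δ β := by
      have := congrArg (Finset.image Prod.fst) h
      simpa [pattern, Finset.image_image, Function.comp_def] using this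
    refine ⟨hL, fun ξ hξ => ?_⟩
    have : (ξ, e α ξ, e β ξ) ∈ pattern C e δ' α' β' := h ▸ Finset.mem_image_of_mem _ hξ
    obtain ⟨ζ, -, hζ⟩ := Finset.mem_image.1 this
    simp only [Prod.mk.injEq] at hζ
    obtain ⟨rfl, h1, h2⟩ := hζ
    exact ⟨h1, h2⟩
  · rintro ⟨hL, h⟩
    unfold pattern
    rw [hL]
    refine Finset.image_congr fun ξ hξ => ?_
    simp only [(h ξ hξ).1, (h ξ hξ).2]

/-- Ladder points of `δ` lie above any finite subset of `δ`. -/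
theorem exists_mem_forall_lt (hC : IsCSequence C) (hδ : δ < ω₁) (hlim : IsSuccLimit δ)
    {S : Set Ordinal.{0}} (hS : S.Finite) (hSδ : S ⊆ Iio δ) :
    ∃ η ∈ C δ, η < δ ∧ ∀ ξ ∈ S, ξ < η := by
  have h1 : hS.toFinset.sup succ < δ :=
    (Finset.sup_lt_iff hlim.bot_lt).2 fun ξ hξ => hlim.succ_lt (hSδ (hS.mem_toFinset.1 hξ))
  obtain ⟨η, hη, hle⟩ := hC.cofinal_of_limit δ hδ hlim _ h1
  exact ⟨η, hη, hC.subset_of_limit δ hδ hlim hη, fun ξ hξ =>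
    succ_le_iff.1 ((Finset.le_sup (f := succ) (hS.mem_toFinset.2 hξ)).trans hle)⟩

theorem finite_ne (he : IsCoherentFiniteToOne e) (hα : α < ω₁) (hβ : β < ω₁) (hδα : δ ≤ α)
    (hδβ : δ ≤ β) : {ξ | ξ < δ ∧ e α ξ ≠ e β ξ}.Finite := by
  rcases lt_trichotomy α β with h | rfl | h
  · exact (he.coherent α β h hβ).subset fun ξ hξ => ⟨hξ.1.trans_le hδα, hξ.2.symm⟩
  · simp
  · exact (he.coherent β α h hα).subset fun ξ hξ => ⟨hξ.1.trans_le hδβ, hξ.2⟩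

/-! ### End-extending the trace below a reflecting ordinal -/

/-- The trace `L(δ, β)` is end-extended by a block `M = L(δ, δ')`, where `δ' > δ` realizes the same
pattern as `δ`; the new functions agree with the old ones on `L(δ, β)` and with each other on `M`.
The block can be placed above any given `r < δ`. -/
theorem IsReflecting.exists_extension (hC : IsCSequence C) (he : IsCoherentFiniteToOne e)
    (hA : A ⊆ Iio ω₁) (hB : B ⊆ Iio ω₁) (hδ : IsReflecting C e A B δ)
    (hα : α ∈ A) (hβ : β ∈ B) (hδα : δ < α) (hδβ : δ < β) (r : Ordinal.{0}) (hr : r < δ) :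
    ∃ α' ∈ A, ∃ β' ∈ B, δ < α' ∧ δ < β' ∧
      (∀ ξ ∈ lowerTrace C δ β, e α' ξ = e α ξ ∧ e β' ξ = e β ξ) ∧
      ∃ M : Finset Ordinal.{0}, M.Nonempty ∧ lowerTrace C δ β' = lowerTrace C δ β ∪ M ∧
        (∀ ξ ∈ lowerTrace C δ β, ∀ ζ ∈ M, ξ < ζ) ∧ ∀ ζ ∈ M, r ≤ ζ ∧ ζ < δ ∧ e α' ζ = e β' ζ := by
  have h0 : 0 < δ := hδ.isSuccLimit.bot_lt
  have hL : ∀ ξ ∈ lowerTrace C δ β, ξ < δ := fun ξ => lt_of_mem_lowerTrace hC h0 hδβ (hB hβ)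
  -- The ladder point `η` of `δ` is also required of `δ'`, which keeps `L(δ, δ')` above `η`.
  obtain ⟨η, hηC, hηδ, hη⟩ := exists_mem_forall_lt hC hδ.lt_omega_one hδ.isSuccLimit
    (S := lowerTrace C δ β ∪ {ξ | ξ < δ ∧ e α ξ ≠ e β ξ} ∪ {r})
    (((lowerTrace C δ β).finite_toSet.union
      (finite_ne he (hA hα) (hB hβ) hδα.le hδβ.le)).union (finite_singleton r)) (by
      rintro ξ ((hξ | hξ) | rfl)
      · exact hL ξ hξ
      · exact hξ.1
      · exact hr)
  have hmem : δ ∈ patternLevels C e A B (pattern C e δ α β) η :=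
    ⟨hδ.lt_omega_one, hδ.isSuccLimit, hηC, α, hα, β, hβ, hδα, hδβ, rfl, fun ξ h1 h2 =>
      by_contra fun hne => (hη ξ (.inl (.inr ⟨h2, hne⟩))).not_ge h1⟩
  obtain ⟨δ', ⟨hδ'1, hδ'2, hηC', α', hα', β', hβ', h1, h2, hp, heq⟩, hlt⟩ := hδ.exists_gt _
    (fst_lt_of_mem_pattern hC h0 hδβ (hB hβ)) η hηδ hmem
  obtain ⟨hL', hag⟩ := pattern_eq_iff.1 hp
  have hM : ∀ ζ ∈ lowerTrace C δ δ', η ≤ ζ ∧ ζ < δ := fun ζ hζ =>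
    ⟨le_of_mem_lowerTrace hηC' hηδ hζ, lt_of_mem_lowerTrace hC h0 hlt hδ'1 hζ⟩
  have hlt' : ∀ ξ ∈ lowerTrace C δ β, ∀ ζ ∈ lowerTrace C δ δ', ξ < ζ := fun ξ hξ ζ hζ =>
    (hη ξ (.inl (.inl hξ))).trans_le (hM ζ hζ).1
  refine ⟨α', hα', β', hβ', hlt.trans h1, hlt.trans h2, hag, lowerTrace C δ δ',
    lowerTrace_nonempty hC hlt hδ'1, ?_, hlt', fun ζ hζ => ⟨?_, (hM ζ hζ).2, ?_⟩⟩
  · rw [← hL']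
    exact lowerTrace_eq_union hC hlt h2 (hB hβ') (hL' ▸ hlt')
  · exact (hη r (.inr rfl)).le.trans (hM ζ hζ).1
  · exact heq ζ (hM ζ hζ).1 ((hM ζ hζ).2.trans hlt)

/-- As `IsReflecting.exists_extension`, but with `e α'` above `e β'` on the new block: `β'` is taken
from there, and `α'` is then chosen with values on `M` exceeding all those of `e β'`. -/
theorem IsReflecting.exists_extension_lt (hC : IsCSequence C) (he : IsCoherentFiniteToOne e)
    (hA : A ⊆ Iio ω₁) (hB : B ⊆ Iio ω₁) (hδ : IsReflecting C e A B δ)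
    (hα : α ∈ A) (hβ : β ∈ B) (hδα : δ < α) (hδβ : δ < β) :
    ∃ α' ∈ A, ∃ β' ∈ B, δ < α' ∧ δ < β' ∧
      (∀ ξ ∈ lowerTrace C δ β, e α' ξ = e α ξ ∧ e β' ξ = e β ξ) ∧
      ∃ M : Finset Ordinal.{0}, M.Nonempty ∧ lowerTrace C δ β' = lowerTrace C δ β ∪ M ∧
        (∀ ξ ∈ lowerTrace C δ β, ∀ ζ ∈ M, ξ < ζ) ∧ ∀ ζ ∈ M, e β' ζ < e α' ζ := by
  obtain ⟨x, hx, hlarge⟩ := hδ.exists_large (pattern C e δ α β)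
    (fst_lt_of_mem_pattern hC hδ.isSuccLimit.bot_lt hδβ (hB hβ))
    ⟨α, mem_matching_pattern.2 ⟨hα, fun _ _ => rfl⟩, hδα.le⟩
  obtain ⟨α₁, -, β', hβ', -, hδβ', hag, M, hM, hL, hlt, hMx⟩ :=
    hδ.exists_extension hC he hA hB hα hβ hδα hδβ x hx
  obtain ⟨α', hα', hδα', h⟩ := hlarge M
    (fun ζ hζ => ⟨(hMx ζ hζ).1, (hMx ζ hζ).2.1.trans hδ.lt_omega_one⟩) (M.sup (e β'))
  rw [mem_matching_pattern] at hα'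
  exact ⟨α', hα'.1, β', hβ', hδα', hδβ', fun ξ hξ => ⟨hα'.2 ξ hξ, (hag ξ hξ).2⟩, M, hM, hL, hlt,
    fun ζ hζ => (Finset.le_sup (f := e β') hζ).trans_lt (h ζ hζ)⟩

/-- Extending by a block of equality and then by a block where `e α' > e β'` adds one oscillation,
and the extended trace ends at a point where `e α' > e β'`. -/
theorem IsReflecting.exists_card_oscSet_succ (hC : IsCSequence C) (he : IsCoherentFiniteToOne e)
    (hA : A ⊆ Iio ω₁) (hB : B ⊆ Iio ω₁) (hδ : IsReflecting C e A B δ)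
    (hα : α ∈ A) (hβ : β ∈ B) (hδα : δ < α) (hδβ : δ < β) :
    ∃ α' ∈ A, ∃ β' ∈ B, δ < α' ∧ δ < β' ∧ lowerTrace C δ β ⊆ lowerTrace C δ β' ∧
      (∀ ξ ∈ lowerTrace C δ β, e α' ξ = e α ξ) ∧
      (oscSet (e α') (e β') (lowerTrace C δ β')).card =
        (oscSet (e α) (e β) (lowerTrace C δ β)).card + 1 ∧
      ∃ h : (lowerTrace C δ β').Nonempty,
        e β' ((lowerTrace C δ β').max' h) < e α' ((lowerTrace C δ β').max' h) := by
  obtain ⟨α₁, hα₁, β₁, hβ₁, hδα₁, hδβ₁, hag₁, M, hM, hL₁, hlt₁, hM'⟩ :=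
    hδ.exists_extension hC he hA hB hα hβ hδα hδβ 0 hδ.isSuccLimit.bot_lt
  obtain ⟨α₂, hα₂, β₂, hβ₂, hδα₂, hδβ₂, hag₂, N, hN, hL₂, hlt₂, hN'⟩ :=
    hδ.exists_extension_lt hC he hA hB hα₁ hβ₁ hδα₁ hδβ₁
  rw [hL₁] at hag₂ hL₂ hlt₂
  have hag : ∀ ξ ∈ lowerTrace C δ β, e α₂ ξ = e α ξ ∧ e β₂ ξ = e β ξ := fun ξ hξ => by
    have := hag₂ ξ (Finset.mem_union_left _ hξ)
    exact ⟨this.1.trans (hag₁ ξ hξ).1, this.2.trans (hag₁ ξ hξ).2⟩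
  have hne : (lowerTrace C δ β₂).Nonempty := lowerTrace_nonempty hC hδβ₂ (hB hβ₂)
  refine ⟨α₂, hα₂, β₂, hβ₂, hδα₂, hδβ₂, ?_, fun ξ hξ => (hag ξ hξ).1, ?_, hne, ?_⟩
  · rw [hL₂]
    exact Finset.subset_union_left.trans Finset.subset_union_left
  · rw [hL₂, card_oscSet_union_union hlt₁ hlt₂ (lowerTrace_nonempty hC hδβ (hB hβ)) hM hN ?_ hN',
      oscSet_congr (fun ξ hξ => (hag ξ hξ).1) fun ξ hξ => (hag ξ hξ).2]
    intro ξ hξ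
    have := hag₂ ξ (Finset.mem_union_right _ hξ)
    rw [this.1, this.2, (hM' ξ hξ).2.2]
  · have h := Finset.max'_mem _ hne
    refine hN' _ ?_
    obtain ⟨ζ, hζ⟩ := hN
    have h1 := Finset.le_max' (lowerTrace C δ β₂) ζ (by rw [hL₂]; exact Finset.mem_union_right _ hζ)
    generalize Finset.max' _ hne = a at *
    rw [hL₂] at h
    exact (Finset.mem_union.1 h).resolve_left fun ha => (hlt₂ a ha ζ hζ).not_ge h1

/-- A single `α` works for all `m ≤ N`, since each new `e α` has the old values on the old
traces. -/
theorem IsReflecting.exists_sequence (hC : IsCSequence C) (he : IsCoherentFiniteToOne e)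
    (hA : A ⊆ Iio ω₁) (hB : B ⊆ Iio ω₁) (hδ : IsReflecting C e A B δ)
    (hα : α ∈ A) (hβ : β ∈ B) (hδα : δ < α) (hδβ : δ < β) :
    ∃ k₀ : ℕ, ∀ N : ℕ, ∃ α ∈ A, δ < α ∧ ∃ β : ℕ → Ordinal.{0}, ∀ m ≤ N, β m ∈ B ∧ δ < β m ∧
      lowerTrace C δ (β m) ⊆ lowerTrace C δ (β N) ∧
      (oscSet (e α) (e (β m)) (lowerTrace C δ (β m))).card = k₀ + m ∧
      ∃ h : (lowerTrace C δ (β m)).Nonempty,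
        e (β m) ((lowerTrace C δ (β m)).max' h) < e α ((lowerTrace C δ (β m)).max' h) := by
  -- One preliminary extension makes the trace end at a point where `e α₀ > e β₀`.
  obtain ⟨α₀, hα₀, β₀, hβ₀, hδα₀, hδβ₀, -, -, -, hne₀, hmax₀⟩ :=
    hδ.exists_card_oscSet_succ hC he hA hB hα hβ hδα hδβ
  refine ⟨(oscSet (e α₀) (e β₀) (lowerTrace C δ β₀)).card, fun N => ?_⟩
  induction N with
  | zero =>
    refine ⟨α₀, hα₀, hδα₀, fun _ => β₀, fun m hm => ?_⟩
    obtain rfl : m = 0 := by omega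
    exact ⟨hβ₀, hδβ₀, subset_rfl, rfl, hne₀, hmax₀⟩
  | succ N ih =>
    obtain ⟨α, hα, hδα, β, h⟩ := ih
    obtain ⟨hβN, hδβN, -, hcardN, -⟩ := h N le_rfl
    obtain ⟨α', hα', β', hβ', hδα', hδβ', hsub, hag, hcard, hne, hmax⟩ :=
      hδ.exists_card_oscSet_succ hC he hA hB hα hβN hδα hδβN
    refine ⟨α', hα', hδα', Function.update β (N + 1) β', fun m hm => ?_⟩
    rw [Function.update_self]
    rcases hm.eq_or_lt with rfl | hm
    · rw [Function.update_self]
      exact ⟨hβ', hδβ', subset_rfl, by rw [hcard, hcardN]; rfl, hne, hmax⟩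
    · rw [Function.update_of_ne hm.ne]
      obtain ⟨h1, h2, h3, h4, h5, h6⟩ := h m (by omega)
      refine ⟨h1, h2, h3.trans hsub, ?_, h5, ?_⟩
      · rw [oscSet_congr (fun ξ hξ => hag ξ (h3 hξ)) fun _ _ => rfl, h4]
      · rwa [hag _ (h3 (Finset.max'_mem _ h5))]

end OrdinalWalk

/-! ### Oscillations of walks through a reflecting ordinal -/

theorem mainTheorem2 (C : Ordinal.{0} → Set Ordinal.{0}) (hC : OrdinalWalk.IsCSequence C)
    (e : Ordinal.{0} → Ordinal.{0} → ℕ) (he : OrdinalWalk.IsCoherentFiniteToOne e)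
    (A B : Set Ordinal.{0}) (hA : A ⊆ Set.Iio ω₁) (hB : B ⊆ Set.Iio ω₁)
    (hAu : ¬ A.Countable) (hBu : ¬ B.Countable) (n : ℕ) :
    ∃ α ∈ A, ∃ β : Fin n → Ordinal.{0}, ∃ k₀ : ℕ,
      (∀ m, β m ∈ B) ∧ (∀ m, α < β m) ∧
        ∀ m : Fin n, OrdinalWalk.osc C e α (β m) = k₀ + (m : ℕ) := by
  open OrdinalWalk in
  have hunb : ∀ S : Set Ordinal.{0}, ¬ S.Countable → ∀ δ < ω₁, ∃ γ ∈ S, δ < γ := by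
    intro S hS δ hδ
    by_contra! h
    exact hS ((countable_Iio_of_lt_omega_one (succ_lt_omega_one hδ)).mono
      fun γ hγ => lt_succ_of_le (h γ hγ))
  obtain ⟨δ, hδ⟩ := exists_isReflecting (B := B) C he hA
  have h0 : 0 < δ := hδ.isSuccLimit.bot_lt
  obtain ⟨α₀, hα₀, hδα₀⟩ := hunb A hAu δ hδ.lt_omega_one
  obtain ⟨β₀, hβ₀, hδβ₀⟩ := hunb B hBu δ hδ.lt_omega_one
  obtain ⟨k₀, hk₀⟩ := hδ.exists_sequence hC he hA hB hα₀ hβ₀ hδα₀ hδβ₀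
  obtain ⟨α, hα, hδα, β, h⟩ := hk₀ n
  obtain ⟨hβn, hδβn, -⟩ := h n le_rfl
  -- Above the ladder point `η`, every `e (β m)` agrees with `e δ`.
  obtain ⟨η, hηC, hηδ, hη⟩ := exists_mem_forall_lt hC hδ.lt_omega_one hδ.isSuccLimit
    (S := lowerTrace C δ (β n) ∪ ⋃ m ≤ n, {ξ | ξ < δ ∧ e (β m) ξ ≠ e δ ξ})
    ((lowerTrace C δ (β n)).finite_toSet.union ((finite_Iic n).biUnion fun m hm =>
      finite_ne he (hB (h m hm).1) hδ.lt_omega_one (h m hm).2.1.le le_rfl)) (by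
      rintro ξ (hξ | hξ)
      · exact lt_of_mem_lowerTrace hC h0 hδβn (hB hβn) hξ
      · simp only [mem_iUnion] at hξ
        obtain ⟨_, _, hξ⟩ := hξ
        exact hξ.1)
  obtain ⟨α', hα', hηα', hα'δ⟩ := hδ.exists_lt (pattern C e δ α (β n))
    (fst_lt_of_mem_pattern hC h0 hδβn (hB hβn)) η hηδ
    ⟨α, mem_matching_pattern.2 ⟨hα, fun _ _ => rfl⟩, hδα.le⟩
  rw [mem_matching_pattern] at hα'
  have hM : ∀ ζ ∈ lowerTrace C α' δ, η ≤ ζ ∧ ζ < δ := fun ζ hζ =>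
    ⟨le_of_mem_lowerTrace hηC hηα' hζ, (lt_of_mem_lowerTrace hC (bot_le.trans_lt hηα') hα'δ
      hδ.lt_omega_one hζ).trans hα'δ⟩
  refine ⟨α', hα'.1, fun m => β m, k₀ + (oscSet (e α') (e δ) (lowerTrace C α' δ)).card,
    fun m => (h m m.2.le).1, fun m => hα'δ.trans (h m m.2.le).2.1, fun m => ?_⟩
  obtain ⟨h1, h2, h3, h4, h5, h6⟩ := h m m.2.le
  have hlt : ∀ ξ ∈ lowerTrace C δ (β m), ∀ ζ ∈ lowerTrace C α' δ, ξ < ζ := fun ξ hξ ζ hζ =>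
    (hη ξ (.inl (h3 hξ))).trans_le (hM ζ hζ).1
  rw [osc, lowerTrace_eq_union hC hα'δ h2 (hB h1) hlt, card_oscSet_union_of_lt hlt h5
    (lowerTrace_nonempty hC hα'δ hδ.lt_omega_one)
    (by rwa [hα'.2 _ (h3 (Finset.max'_mem _ h5))]),
    oscSet_congr (fun ξ hξ => hα'.2 ξ (h3 hξ)) fun _ _ => rfl, h4,
    oscSet_congr (g' := e δ) (fun _ _ => rfl) fun ξ hξ => by_contra fun hne =>
      (hη ξ (.inr (mem_iUnion₂.2 ⟨m, m.2.le, (hM ξ hξ).2, hne⟩))).not_ge (hM ξ hξ).1]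
  omega
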